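/- Work over $\mathbb{C}$ and let $n>2$. Let $P_1,\ldots,P_{n+2}\in\mathbb{P}^n$ be generic points and let $\Lambda\subset\mathbb{P}^n$ be a generic linear space of codimension two, with defining ideals $I_{P_1},\ldots,I_{P_{n+2}},I_\Lambda\subset S=\mathbb{C}[x_0,\ldots,x_n]$; here "generic" means that $(P_1,\ldots,P_{n+2},\Lambda)$ lies in a suitable nonempty Zariski open subset of the variety parametrizing such configurations. Let $X\subset\mathbb{P}^n$ be the scheme with ideal $$I_X=(I_{P_1})^2\cap\cdots\cap(I_{P_{n+2}})^2\cap(I_\Lambda)^2,$$ and let $H(X,4)=\dim_{\mathbb{C}}(S/I_X)_4$ be its Hilbert function in degree $4$. Let $$h=(n+2)(n+1)+\binom{n+2}{4}+2\binom{n+1}{3}$$ be the expected value of $H(X,4)$. Then $X$ does not impose the expected number of conditions on hypersurfaces of degree $4$, that is, $$H(X,4)\leq h-1.$$ -/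

import Mathlib

open scoped LinearAlgebra.Projectivization

noncomputable section

namespace DoubleSchemes

/-- The homogeneous coordinate ring `ℂ[x₀, …, xₙ]` of `ℙⁿ`. -/
abbrev CoordRing (n : ℕ) : Type := MvPolynomial (Fin (n + 1)) ℂ

/-- The defining ideal of the linear subspace `ℙ(W) ⊆ ℙⁿ`, where `W ⊆ ℂⁿ⁺¹` is a vector subspace
(the affine cone over `ℙ(W)`): all polynomials vanishing on `W`. -/
def linearIdeal {n : ℕ} (W : Submodule ℂ (Fin (n + 1) → ℂ)) : Ideal (CoordRing n) :=
  MvPolynomial.vanishingIdeal ℂ (W : Set (Fin (n + 1) → ℂ))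

/-- The degree `d` part of an ideal `I`, as a subspace of the space of forms of degree `d`. -/
def degreePart {n : ℕ} (I : Ideal (CoordRing n)) (d : ℕ) :
    Submodule ℂ (MvPolynomial.homogeneousSubmodule (Fin (n + 1)) ℂ d) :=
  (I.restrictScalars ℂ).comap (MvPolynomial.homogeneousSubmodule (Fin (n + 1)) ℂ d).subtype

/-- The Hilbert function `H(X, d) = dim (ℂ[x₀, …, xₙ] / I)_d` of the subscheme `X` of `ℙⁿ` with
homogeneous ideal `I`. -/
def hilbertFunction {n : ℕ} (I : Ideal (CoordRing n)) (d : ℕ) : ℕ :=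
  Module.finrank ℂ (MvPolynomial.homogeneousSubmodule (Fin (n + 1)) ℂ d ⧸ degreePart I d)

/-- `n + 2` points `P₁, …, Pₙ₊₂` of `ℙⁿ` together with a linear subspace `Λ ⊆ ℙⁿ` of codimension
two, given by its affine cone, a vector subspace of codimension two in `ℂⁿ⁺¹`. -/
structure Configuration (n : ℕ) where
  point : Fin (n + 2) → ℙ ℂ (Fin (n + 1) → ℂ)
  space : Submodule ℂ (Fin (n + 1) → ℂ)
  codim_space : Module.finrank ℂ ((Fin (n + 1) → ℂ) ⧸ space) = 2

/-- The ideal `(I_{P₁})² ∩ … ∩ (I_{Pₙ₊₂})² ∩ (I_Λ)²`. -/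
def Configuration.doubleIdeal {n : ℕ} (c : Configuration n) : Ideal (CoordRing n) :=
  (⨅ i, linearIdeal (c.point i).submodule ^ 2) ⊓ linearIdeal c.space ^ 2

/-- Index set for the coordinates of a configuration: `n + 2` vectors in `ℂⁿ⁺¹` representing the
points, and the coefficient vectors of two linear forms cutting out the linear space. -/
abbrev CoordIndex (n : ℕ) : Type := (Fin (n + 2) ⊕ Fin 2) × Fin (n + 1)

/-- `a` is a system of coordinates of the configuration `c`: the first `n + 2` rows of `a` are
homogeneous coordinates of the points, and the last two rows are the coefficients of two linear
forms (necessarily independent) whose common zero locus is the linear space. -/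
def Configuration.IsCoordinates {n : ℕ} (c : Configuration n) (a : CoordIndex n → ℂ) : Prop :=
  (∀ i, ∃ h : (fun j => a (Sum.inl i, j)) ≠ 0, Projectivization.mk ℂ _ h = c.point i) ∧
  ∀ x : Fin (n + 1) → ℂ, x ∈ c.space ↔ ∀ k : Fin 2, ∑ j, a (Sum.inr k, j) * x j = 0

/-- Zariski open subsets of the parameter variety `(ℙⁿ)ⁿ⁺² × G(n - 2, ℙⁿ)` of configurations: the
set of coordinate systems of members of `U` is the complement of the common zero locus of a set of
polynomials (quotient topology of the Zariski topology on coordinate systems). -/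
def IsZariskiOpen {n : ℕ} (U : Set (Configuration n)) : Prop :=
  ∃ S : Set (MvPolynomial (CoordIndex n) ℂ), ∀ (c : Configuration n) (a : CoordIndex n → ℂ),
    c.IsCoordinates a → (c ∈ U ↔ ∃ F ∈ S, MvPolynomial.eval a F ≠ 0)

/-- A property holds for the generic configuration if it holds on a nonempty Zariski open subset of
the (irreducible) parameter variety. -/
def HoldsGenerically {n : ℕ} (p : Configuration n → Prop) : Prop :=
  ∃ U : Set (Configuration n), IsZariskiOpen U ∧ U.Nonempty ∧ ∀ c ∈ U, p c

/-- The expected value of the Hilbert function in degree `4`: each double point is expected to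
impose `n + 1` conditions, and the double linear space `C(n+2, 4) + 2 C(n+1, 3)` conditions. -/
def expectedHilbert (n : ℕ) : ℕ :=
  (n + 2) * (n + 1) + (n + 2).choose 4 + 2 * (n + 1).choose 3

end DoubleSchemes

end

open scoped LinearAlgebra.Projectivization

/-! ### Conditions imposed by one double linear space. -/

namespace DoubleSchemes

open MvPolynomial Module

/-! A rational normal curve of degree `n` passes through all `n + 2` points and meets `Λ` in `n - 1`
points, counted with multiplicity. A quartic restricts to it as a binary form of degree `4n`. Being
double at the first `n + 1` points and along `Λ` already gives `2(n + 1) + 2(n - 1) = 4n` zeros; if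
the quartic also vanishes at the last point, it vanishes on the whole curve, and its derivative
along the curve at that point is zero for free. So the conditions are dependent.

`exists_quartic_sub_notMem` is this argument, with the last point at parameter infinity.
`finrank_quotient_iInf_inf_lt` turns it into a strict inequality against the sum of the separate
codimensions, which `finrank_quotient_linearIdeal_sq_le` bounds by the summands of the expected
value. Everything needed of the configuration is in `Configuration.IsGeneral`, the nonvanishing of
`generalPolynomial`. -/

/-- The linear form on `ℂⁿ⁺¹` given by `φ`, as a polynomial. -/
noncomputable def linForm (n : ℕ) : Dual ℂ (Fin (n + 1) → ℂ) →ₗ[ℂ] CoordRing n where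
  toFun φ := ∑ k, φ (Pi.single k 1) • X k
  map_add' φ ψ := by simp [add_smul, Finset.sum_add_distrib]
  map_smul' c φ := by simp [mul_smul, Finset.smul_sum]

lemma linForm_apply {n : ℕ} (φ : Dual ℂ (Fin (n + 1) → ℂ)) :
    linForm n φ = ∑ k, φ (Pi.single k 1) • X k := rfl

lemma aeval_linForm {n : ℕ} {A : Type*} [CommRing A] [Algebra ℂ A]
    (φ : Dual ℂ (Fin (n + 1) → ℂ)) (x : Fin (n + 1) → A) :
    aeval x (linForm n φ) = ∑ k, φ (Pi.single k 1) • x k := by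
  simp [linForm_apply]

lemma aeval_linForm_self {n : ℕ} (φ : Dual ℂ (Fin (n + 1) → ℂ)) (x : Fin (n + 1) → ℂ) :
    aeval x (linForm n φ) = φ x := by
  rw [aeval_linForm, LinearMap.pi_apply_eq_sum_univ φ x]
  refine Finset.sum_congr rfl fun k _ => ?_
  rw [smul_eq_mul, smul_eq_mul, mul_comm]
  congr 2
  ext j
  simp [Pi.single_apply, eq_comm]

lemma isHomogeneous_linForm {n : ℕ} (φ : Dual ℂ (Fin (n + 1) → ℂ)) :
    (linForm n φ).IsHomogeneous 1 := by
  rw [linForm_apply]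
  refine IsHomogeneous.sum _ _ _ fun k _ => ?_
  rw [smul_eq_C_mul]
  simpa using (isHomogeneous_C _ (φ (Pi.single k 1))).mul (isHomogeneous_X ℂ k)

lemma homogeneousSubmodule_one_le_span {n : ℕ} {ι : Type*} [Finite ι]
    (b : Basis ι ℂ (Fin (n + 1) → ℂ)) :
    homogeneousSubmodule (Fin (n + 1)) ℂ 1 ≤
      Submodule.span ℂ (Set.range fun i => linForm n (b.coord i)) := by
  classical
  have := Fintype.ofFinite ι
  rw [homogeneousSubmodule_one_eq_span_X, Submodule.span_le]
  rintro _ ⟨k, rfl⟩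
  have hX : (X k : CoordRing n) = linForm n (LinearMap.proj k) := by
    rw [linForm_apply, Finset.sum_eq_single k] <;> simp +contextual [eq_comm]
  have hspan : (LinearMap.proj k : Dual ℂ (Fin (n + 1) → ℂ)) =
      ∑ i, b i k • b.coord i := by
    refine b.ext fun i => ?_
    simp [Finsupp.single_apply]
  rw [SetLike.mem_coe, hX, hspan, map_sum]
  refine Submodule.sum_mem _ fun i _ => ?_
  rw [map_smul]
  exact Submodule.smul_mem _ _ (Submodule.subset_span ⟨i, rfl⟩)

/-- Two factors `inl` put a monomial in the square of the ideal, so only the first two kinds survive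
in the quotient. -/
lemma multiset_sum_cases {κ μ : Type*} (s : Multiset (κ ⊕ μ)) :
    (∃ t : Multiset μ, s = t.map Sum.inr) ∨
    (∃ (i : κ) (t : Multiset μ), s = Sum.inl i ::ₘ t.map Sum.inr) ∨
    ∃ (i j : κ) (t : Multiset (κ ⊕ μ)), s = Sum.inl i ::ₘ Sum.inl j ::ₘ t := by
  induction s using Multiset.induction_on with
  | empty => exact Or.inl ⟨0, by simp⟩
  | cons x s ih =>
    rcases ih with ⟨t, rfl⟩ | ⟨i, t, rfl⟩ | ⟨i, j, t, rfl⟩ <;> rcases x with x | x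
    · exact Or.inr (Or.inl ⟨x, t, rfl⟩)
    · exact Or.inl ⟨x ::ₘ t, by simp⟩
    · exact Or.inr (Or.inr ⟨x, i, _, rfl⟩)
    · exact Or.inr (Or.inl ⟨i, x ::ₘ t, by simp [Multiset.cons_swap]⟩)
    · exact Or.inr (Or.inr ⟨x, i, _, rfl⟩)
    · exact Or.inr (Or.inr ⟨i, j, Sum.inr x ::ₘ t, by
        rw [Multiset.cons_swap, Multiset.cons_swap (Sum.inr x)]⟩)

lemma isHomogeneous_multiset_prod {σ ι : Type*} {y : ι → MvPolynomial σ ℂ}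
    (hy : ∀ i, (y i).IsHomogeneous 1) (s : Multiset ι) :
    (s.map y).prod.IsHomogeneous (Multiset.card s) := by
  induction s using Multiset.induction_on with
  | empty => simpa using isHomogeneous_one σ ℂ
  | cons i s ih => simpa [add_comm] using (hy i).mul ih

/-- Modulo the square of an ideal containing the linear forms `y (inl i)`, forms of degree `d + 1`
are spanned by the monomials in the `y` with at most one factor `y (inl i)`. -/
lemma finrank_quotient_sq_le {n d : ℕ} {κ μ : Type*} [Fintype κ] [Fintype μ]
    (I : Ideal (CoordRing n)) (y : κ ⊕ μ → CoordRing n) (hy : ∀ i, (y i).IsHomogeneous 1)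
    (hspan : homogeneousSubmodule (Fin (n + 1)) ℂ 1 ≤ Submodule.span ℂ (Set.range y))
    (hI : ∀ i, y (Sum.inl i) ∈ I) :
    finrank ℂ (homogeneousSubmodule (Fin (n + 1)) ℂ (d + 1) ⧸ degreePart (I ^ 2) (d + 1)) ≤
      (Fintype.card μ).multichoose (d + 1) +
        Fintype.card κ * (Fintype.card μ).multichoose d := by
  classical
  let v : Sym μ (d + 1) ⊕ κ × Sym μ d → homogeneousSubmodule (Fin (n + 1)) ℂ (d + 1) :=
    Sum.elim
      (fun s => ⟨(s.1.map fun j => y (Sum.inr j)).prod, by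
        have := isHomogeneous_multiset_prod (fun j => hy (Sum.inr j)) s.1
        rwa [s.2] at this⟩)
      (fun p => ⟨y (Sum.inl p.1) * (p.2.1.map fun j => y (Sum.inr j)).prod, by
        have := (hy (Sum.inl p.1)).mul
          (isHomogeneous_multiset_prod (fun j => hy (Sum.inr j)) p.2.1)
        rwa [p.2.2, add_comm 1 d] at this⟩)
  have key : homogeneousSubmodule (Fin (n + 1)) ℂ (d + 1) ≤
      Submodule.span ℂ (Set.range fun s => (v s : CoordRing n)) ⊔
        (I ^ 2).restrictScalars ℂ := by
    refine (homogeneousSubmodule_one_pow ℂ (d + 1)).ge.trans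
      ((pow_le_pow_left₀ bot_le hspan _).trans ?_)
    rw [Submodule.span_pow, Submodule.span_le]
    intro F hF
    rw [Set.mem_pow] at hF
    obtain ⟨f, rfl⟩ := hF
    choose j hj using fun i => (f i).2
    obtain ⟨s, hs, hprod⟩ : ∃ s : Multiset (κ ⊕ μ), Multiset.card s = d + 1 ∧
        (List.ofFn fun i => (f i : CoordRing n)).prod = (s.map y).prod := by
      refine ⟨(List.ofFn j : Multiset _), by simp, ?_⟩
      simp [List.map_ofFn, Function.comp_def, hj]
    rw [SetLike.mem_coe, hprod]
    rcases multiset_sum_cases s with ⟨t, rfl⟩ | ⟨i, t, rfl⟩ | ⟨i, i', t, rfl⟩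
    · refine Submodule.mem_sup_left (Submodule.subset_span ⟨Sum.inl ⟨t, by simpa using hs⟩, ?_⟩)
      rw [Multiset.map_map]
      rfl
    · refine Submodule.mem_sup_left
        (Submodule.subset_span ⟨Sum.inr (i, ⟨t, by simpa using hs⟩), ?_⟩)
      rw [Multiset.map_cons, Multiset.prod_cons, Multiset.map_map]
      rfl
    · refine Submodule.mem_sup_right ?_
      rw [Submodule.restrictScalars_mem, Multiset.map_cons, Multiset.map_cons, Multiset.prod_cons,
        Multiset.prod_cons, ← mul_assoc, pow_two]
      exact Ideal.mul_mem_right _ _ (Ideal.mul_mem_mul (hI i) (hI i'))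
  have htop : Submodule.span ℂ (Set.range fun s => (degreePart (I ^ 2) (d + 1)).mkQ (v s)) = ⊤ := by
    rw [eq_top_iff]
    rintro x -
    obtain ⟨F, rfl⟩ := Submodule.mkQ_surjective _ x
    obtain ⟨A, hA, B, hB, hAB⟩ := Submodule.mem_sup.1 (key F.2)
    have hA' : A ∈ (Submodule.span ℂ (Set.range v)).map
        (homogeneousSubmodule (Fin (n + 1)) ℂ (d + 1)).subtype := by
      rw [Submodule.map_span, ← Set.range_comp]
      exact hA
    obtain ⟨A, hA₀, rfl⟩ := hA'
    have hF : (degreePart (I ^ 2) (d + 1)).mkQ F = (degreePart (I ^ 2) (d + 1)).mkQ A := by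
      rw [← sub_eq_zero, ← map_sub, Submodule.mkQ_apply, Submodule.Quotient.mk_eq_zero]
      change ((F - A : homogeneousSubmodule (Fin (n + 1)) ℂ (d + 1)) : CoordRing n) ∈ I ^ 2
      have : ((F - A : homogeneousSubmodule (Fin (n + 1)) ℂ (d + 1)) : CoordRing n) = B := by
        rw [Submodule.coe_sub, ← hAB]; simp
      rw [this]
      exact hB
    rw [hF]
    have := Submodule.mem_map_of_mem (f := (degreePart (I ^ 2) (d + 1)).mkQ) hA₀
    rwa [Submodule.map_span, ← Set.range_comp] at this
  rw [← finrank_top, ← htop]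
  refine (finrank_range_le_card _).trans ?_
  simp [Sym.card_sym_eq_multichoose]

lemma finrank_quotient_linearIdeal_sq_le {n : ℕ} (W : Submodule ℂ (Fin (n + 1) → ℂ)) (d : ℕ) :
    finrank ℂ (homogeneousSubmodule (Fin (n + 1)) ℂ (d + 1) ⧸
        degreePart (linearIdeal W ^ 2) (d + 1)) ≤
      (finrank ℂ W).multichoose (d + 1) +
        finrank ℂ ((Fin (n + 1) → ℂ) ⧸ W) * (finrank ℂ W).multichoose d := by
  -- The coordinates along a complement of `W` vanish on `W`; they play the role of the `inl` forms.
  obtain ⟨W', hW'⟩ := W.exists_isCompl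
  let b := ((finBasis ℂ W').prod (finBasis ℂ W)).map (W'.prodEquivOfIsCompl W hW'.symm)
  have := finrank_quotient_sq_le (d := d) (linearIdeal W) (fun i => linForm n (b.coord i))
    (fun i => isHomogeneous_linForm _) (homogeneousSubmodule_one_le_span b) (fun i x hx => by
      rw [aeval_linForm_self]
      have : (W'.prodEquivOfIsCompl W hW'.symm).symm x = (0, ⟨x, hx⟩) := by
        rw [LinearEquiv.symm_apply_eq]; simp
      simp [b, this])
  rw [(Submodule.quotientEquivOfIsCompl W W' hW').finrank_eq]
  simpa using this

end DoubleSchemes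

/-! ### Pulling forms back to polynomial curves. -/

namespace DoubleSchemes

open Polynomial Module

lemma dvd_aeval_sub_aeval {σ : Type*} {x y : σ → ℂ[X]} {g : ℂ[X]} (h : ∀ k, g ∣ x k - y k)
    (F : MvPolynomial σ ℂ) : g ∣ MvPolynomial.aeval x F - MvPolynomial.aeval y F := by
  rw [← Ideal.mem_span_singleton, ← Ideal.Quotient.eq]
  have : ((Ideal.Quotient.mkₐ ℂ (Ideal.span {g})).comp (MvPolynomial.aeval x)) =
      ((Ideal.Quotient.mkₐ ℂ (Ideal.span {g})).comp (MvPolynomial.aeval y)) := by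
    refine MvPolynomial.algHom_ext fun k => ?_
    simpa [Ideal.Quotient.eq, Ideal.mem_span_singleton] using h k
  exact DFunLike.congr_fun this F

lemma eval_aeval {σ : Type*} (x : σ → ℂ[X]) (t : ℂ) (F : MvPolynomial σ ℂ) :
    (MvPolynomial.aeval x F).eval t = MvPolynomial.aeval (fun k => (x k).eval t) F := by
  have : (Polynomial.aeval t).comp (MvPolynomial.aeval x) =
      MvPolynomial.aeval (R := ℂ) (fun k => (x k).eval t) := by
    refine MvPolynomial.algHom_ext fun k => ?_
    simp [Polynomial.coe_aeval_eq_eval]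
  simpa [Polynomial.coe_aeval_eq_eval] using DFunLike.congr_fun this F

/-- If a parametrized curve agrees modulo `g` with one lying in `W`, then pulling back to it the
square of the ideal of `W` gives multiples of `g ^ 2`. -/
lemma sq_dvd_aeval {n : ℕ} {W : Submodule ℂ (Fin (n + 1) → ℂ)} {γ ρ : Fin (n + 1) → ℂ[X]}
    {g : ℂ[X]} (hρ : ∀ t, (fun k => (ρ k).eval t) ∈ W) (h : ∀ k, g ∣ γ k - ρ k)
    {F : CoordRing n} (hF : F ∈ linearIdeal W ^ 2) : g ^ 2 ∣ MvPolynomial.aeval γ F := by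
  have hle : linearIdeal W ≤ (Ideal.span {g}).comap (MvPolynomial.aeval γ) := by
    intro f hf
    rw [Ideal.mem_comap, Ideal.mem_span_singleton]
    have h0 : MvPolynomial.aeval ρ f = 0 := by
      refine Polynomial.funext fun t => ?_
      rw [eval_aeval, eval_zero]
      exact hf _ (hρ t)
    simpa [h0] using dvd_aeval_sub_aeval h f
  have := Ideal.le_comap_pow _ 2 (Ideal.pow_right_mono hle 2 hF)
  rwa [Ideal.mem_comap, Ideal.span_singleton_pow, Ideal.mem_span_singleton] at this

/-- Reflection inverts the parameter: `F(s^N γ(1/s)) = s^(dN) F(γ(1/s))` for a form of degree `d`.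
This gives access to the point at infinity of the curve. -/
lemma natDegree_aeval_le_and_reflect_aeval {σ : Type*} {γ δ : σ → ℂ[X]} {N : ℕ}
    (hγ : ∀ k, (γ k).natDegree ≤ N) (hδ : ∀ k, (γ k).reflect N = δ k) {d : ℕ}
    {F : MvPolynomial σ ℂ} (hF : F ∈ MvPolynomial.homogeneousSubmodule σ ℂ d) :
    (MvPolynomial.aeval γ F).natDegree ≤ d * N ∧
      (MvPolynomial.aeval γ F).reflect (d * N) = MvPolynomial.aeval δ F := by
  induction d generalizing F with
  | zero =>
    rw [MvPolynomial.mem_homogeneousSubmodule, ← MvPolynomial.totalDegree_zero_iff_isHomogeneous,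
      MvPolynomial.totalDegree_eq_zero_iff_eq_C] at hF
    rw [hF]
    simp [Polynomial.algebraMap_eq, -map_natCast]
  | succ d ih =>
    rw [← MvPolynomial.homogeneousSubmodule_one_pow, pow_succ,
      MvPolynomial.homogeneousSubmodule_one_pow,
      MvPolynomial.homogeneousSubmodule_one_eq_span_X] at hF
    induction hF using Submodule.mul_induction_on' with
    | mem_mul_mem f hf l hl =>
      obtain ⟨h1, h2⟩ := ih hf
      have hl' : (MvPolynomial.aeval γ l).natDegree ≤ N ∧
          (MvPolynomial.aeval γ l).reflect N = MvPolynomial.aeval δ l := by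
        induction hl using Submodule.span_induction with
        | mem x hx =>
          obtain ⟨k, rfl⟩ := hx
          simp [hγ, hδ]
        | zero => simp
        | add x y _ _ hx hy =>
          rw [map_add, map_add, reflect_add, hx.2, hy.2]
          exact ⟨natDegree_add_le_of_degree_le hx.1 hy.1, rfl⟩
        | smul c x _ hx =>
          rw [map_smul, map_smul, smul_eq_C_mul, smul_eq_C_mul, reflect_C_mul, hx.2]
          exact ⟨(natDegree_C_mul_le _ _).trans hx.1, rfl⟩
      rw [map_mul, map_mul, Nat.succ_mul, reflect_mul _ _ h1 hl'.1, h2, hl'.2]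
      exact ⟨natDegree_mul_le_of_le h1 hl'.1, rfl⟩
    | add x _ y _ hx hy =>
      rw [map_add, map_add, reflect_add, hx.2, hy.2]
      exact ⟨natDegree_add_le_of_degree_le hx.1 hy.1, rfl⟩

/-! ### The polynomials parametrizing the rational normal curve. -/

/-- The polynomial `∏_{j ≠ i} (X - t_j)`. -/
noncomputable def nodalExcept {m : ℕ} (t : Fin m → ℂ) (i : Fin m) : ℂ[X] :=
  ∏ j ∈ Finset.univ.erase i, (X - C (t j))

/-- The polynomial `∏_{j ≠ i} (1 - t_j X)`. -/
noncomputable def revNodalExcept {m : ℕ} (t : Fin m → ℂ) (i : Fin m) : ℂ[X] :=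
  ∏ j ∈ Finset.univ.erase i, (1 - C (t j) * X)

section

variable {n : ℕ} (t : Fin (n + 1) → ℂ)

lemma nodalExcept_monic (i) : (nodalExcept t i).Monic := monic_prod_X_sub_C _ _

lemma natDegree_nodalExcept (i) : (nodalExcept t i).natDegree = n := by
  rw [nodalExcept, natDegree_finsetProd_X_sub_C_eq_card]
  simp

lemma eval_nodalExcept_self {i} (ht : Function.Injective t) : (nodalExcept t i).eval (t i) ≠ 0 := by
  rw [nodalExcept, eval_prod, Finset.prod_ne_zero_iff]
  intro j hj
  simpa [sub_eq_zero] using fun h => (Finset.ne_of_mem_erase hj) (ht h).symm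

lemma eval_nodalExcept_of_ne {i j} (h : j ≠ i) : (nodalExcept t i).eval (t j) = 0 := by
  rw [nodalExcept, eval_prod]
  exact Finset.prod_eq_zero (Finset.mem_erase.2 ⟨h, Finset.mem_univ j⟩) (by simp)

lemma X_sub_C_mul_nodalExcept (i) :
    (X - C (t i)) * nodalExcept t i = ∏ j, (X - C (t j)) := by
  rw [nodalExcept]
  exact Finset.mul_prod_erase Finset.univ (fun j => X - C (t j)) (Finset.mem_univ i)

lemma reflect_nodalExcept (i) : (nodalExcept t i).reflect n = revNodalExcept t i := by
  have key : ∀ s : Finset (Fin (n + 1)), (∏ j ∈ s, (X - C (t j))).reflect s.card =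
      ∏ j ∈ s, (1 - C (t j) * X) := by
    intro s
    induction s using Finset.induction_on with
    | empty => simp [reflect_one]
    | insert a s ha ih =>
      rw [Finset.prod_insert ha, Finset.prod_insert ha, Finset.card_insert_of_notMem ha, add_comm,
        reflect_mul _ _ (natDegree_X_sub_C_le _) (natDegree_finsetProd_X_sub_C_eq_card _ _).le, ih]
      congr 1
      rw [sub_eq_add_neg, ← C_neg, reflect_add, reflect_one_X, reflect_C]
      simp [sub_eq_add_neg]
  simpa [nodalExcept, revNodalExcept] using key (Finset.univ.erase i)

lemma eval_zero_revNodalExcept (i) : (revNodalExcept t i).eval 0 = 1 := by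
  simp [revNodalExcept, eval_prod]

lemma revNodalExcept_sub {i j : Fin (n + 1)} (h : i ≠ j) : ∃ q : ℂ[X], q.eval 0 = 1 ∧
    revNodalExcept t i - revNodalExcept t j = X * C (t i - t j) * q := by
  refine ⟨∏ k ∈ (Finset.univ.erase i).erase j, (1 - C (t k) * X), by simp [eval_prod], ?_⟩
  rw [revNodalExcept, revNodalExcept, ← Finset.mul_prod_erase _ _
    (Finset.mem_erase.2 ⟨h.symm, Finset.mem_univ j⟩), ← Finset.mul_prod_erase (Finset.univ.erase j)
    _ (Finset.mem_erase.2 ⟨h, Finset.mem_univ i⟩), Finset.erase_right_comm (a := j), C_sub]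
  ring

end

end DoubleSchemes

/-! ### The rational normal curve and the zero count. -/

namespace DoubleSchemes

open Polynomial Module

lemma aeval_linForm_coord {n : ℕ} (e : Basis (Fin (n + 1)) ℂ (Fin (n + 1) → ℂ))
    (R : Fin (n + 1) → ℂ[X]) (j : Fin (n + 1)) :
    MvPolynomial.aeval (fun k => ∑ i, C (e i k) * R i) (linForm n (e.coord j)) = R j := by
  classical
  rw [aeval_linForm]
  simp_rw [Finset.smul_sum, smul_eq_C_mul, ← mul_assoc, ← C_mul]
  rw [Finset.sum_comm]
  simp_rw [← Finset.sum_mul, ← map_sum]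
  have h : ∀ i, ∑ k, e.coord j (Pi.single k 1) * e i k = if i = j then 1 else 0 := by
    intro i
    have h1 := aeval_linForm (A := ℂ) (e.coord j) (e i)
    rw [aeval_linForm_self] at h1
    simp only [smul_eq_mul] at h1
    rw [← h1]
    simp [Finsupp.single_apply]
  simp_rw [h]
  simp

section

variable {n : ℕ} (e : Basis (Fin (n + 1)) ℂ (Fin (n + 1) → ℂ)) (t b : Fin (n + 1) → ℂ)

/-- The rational normal curve through the `e i`, at parameter `t i`, and `∑ i, e i`, at infinity. -/
noncomputable def curve (k : Fin (n + 1)) : ℂ[X] := ∑ i, C (e i k) * nodalExcept t i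

/-- The rational normal curve `curve` with the parameter inverted. -/
noncomputable def revCurve (k : Fin (n + 1)) : ℂ[X] := ∑ i, C (e i k) * revNodalExcept t i

/-- The polynomial whose roots are the parameters where `curve` meets the codimension two space. -/
noncomputable def incidence : ℂ[X] := ∑ i, C (b i) * nodalExcept t i

lemma natDegree_curve_le (k) : (curve e t k).natDegree ≤ n := by
  refine natDegree_sum_le_of_forall_le _ _ fun i _ => ?_
  exact (natDegree_C_mul_le _ _).trans (natDegree_nodalExcept t i).le

lemma reflect_sum {ι : Type*} (s : Finset ι) (f : ι → ℂ[X]) (N : ℕ) :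
    (∑ i ∈ s, f i).reflect N = ∑ i ∈ s, (f i).reflect N := by
  classical
  induction s using Finset.induction_on with
  | empty => simp
  | insert a s ha ih => rw [Finset.sum_insert ha, Finset.sum_insert ha, reflect_add, ih]

lemma reflect_curve (k) : (curve e t k).reflect n = revCurve e t k := by
  simp [curve, revCurve, reflect_sum, reflect_C_mul, reflect_nodalExcept]

lemma eval_sum_nodalExcept (c : Fin (n + 1) → ℂ) (i) :
    (∑ j, C (c j) * nodalExcept t j).eval (t i) = c i * (nodalExcept t i).eval (t i) := by
  rw [eval_finsetSum, Finset.sum_eq_single i]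
  · simp
  · intro j _ hj
    rw [eval_mul, eval_nodalExcept_of_ne t hj.symm, mul_zero]
  · simp

variable {t b}

/-- Each `(X - t i) * nodalExcept t i` is the full product, so their combination with coefficients
`b i` is `(∑ b i)` times it, hence zero. -/
lemma X_mul_incidence (hb : ∑ i, b i = 0) :
    X * incidence t b = ∑ i, C (b i * t i) * nodalExcept t i := by
  have h : ∑ i, C (b i) * ((X - C (t i)) * nodalExcept t i) = 0 := by
    simp_rw [X_sub_C_mul_nodalExcept]
    rw [← Finset.sum_mul, ← map_sum, hb, C_0, zero_mul]
  rw [← sub_eq_zero, ← h, incidence, Finset.mul_sum, ← Finset.sum_sub_distrib]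
  refine Finset.sum_congr rfl fun i _ => ?_
  rw [C_mul]
  ring

/-- The coefficient of `X ^ n` is `∑ b i * t i`. Consequently `incidence` has degree `n - 1`, one
less than its summands. -/
lemma X_mul_incidence_monic (hb : ∑ i, b i = 0) (hbt : ∑ i, b i * t i = 1) :
    (X * incidence t b).Monic ∧ (X * incidence t b).natDegree = n := by
  have hle : (X * incidence t b).natDegree ≤ n := by
    rw [X_mul_incidence hb]
    refine natDegree_sum_le_of_forall_le _ _ fun i _ => ?_
    exact (natDegree_C_mul_le _ _).trans (natDegree_nodalExcept t i).le
  have hc : (X * incidence t b).coeff n = 1 := by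
    rw [X_mul_incidence hb, finsetSum_coeff, ← hbt]
    refine Finset.sum_congr rfl fun i _ => ?_
    have := (nodalExcept_monic t i).coeff_natDegree
    rw [natDegree_nodalExcept] at this
    rw [coeff_C_mul, this, mul_one]
  exact ⟨monic_of_natDegree_le_of_coeff_eq_one n hle hc,
    natDegree_eq_of_le_of_coeff_ne_zero hle (by rw [hc]; exact one_ne_zero)⟩

lemma sq_dvd_aeval_curve (ht : Function.Injective t) (hb0 : ∀ i, b i ≠ 0) (hb : ∑ i, b i = 0)
    {Λ : Submodule ℂ (Fin (n + 1) → ℂ)} {w : Fin (n + 1) → ℂ}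
    (hΛ : ∀ i, e i - (b i * t i) • ∑ j, e j - b i • w ∈ Λ) {F : CoordRing n}
    (hF : ∀ i, F ∈ linearIdeal (ℂ ∙ e i) ^ 2) (hFΛ : F ∈ linearIdeal Λ ^ 2) :
    ((∏ i, (X - C (t i))) * incidence t b) ^ 2 ∣ MvPolynomial.aeval (curve e t) F := by
  have hpt : ∀ i, (X - C (t i)) ^ 2 ∣ MvPolynomial.aeval (curve e t) F := by
    intro i
    refine sq_dvd_aeval (ρ := fun k => C (e i k * (nodalExcept t i).eval (t i)))
      (fun s => ?_) (fun k => ?_) (hF i)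
    · refine Submodule.mem_span_singleton.2 ⟨(nodalExcept t i).eval (t i), ?_⟩
      ext k
      simp [mul_comm]
    · rw [dvd_iff_isRoot, IsRoot.def, eval_sub, curve, eval_sum_nodalExcept, eval_C, sub_self]
  have hinc : incidence t b ^ 2 ∣ MvPolynomial.aeval (curve e t) F := by
    -- With `p = ∑ e j`, `hΛ` reads `e i ≡ b i (t i p + w)` modulo `Λ`, so the curve is congruent to
    -- `incidence * (X p + w)`; subtracting this lands in `Λ`. Working modulo `incidence`, not root
    -- by root, allows multiple roots.
    refine sq_dvd_aeval (ρ := fun k =>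
      curve e t k - incidence t b * (X * C ((∑ j, e j) k) + C (w k))) (fun s => ?_)
      (fun k => ?_) hFΛ
    · have h1 := congrArg (eval s) (X_mul_incidence (t := t) hb)
      have h2 : (incidence t b).eval s = ∑ i, b i * (nodalExcept t i).eval s := by
        simp [incidence, eval_finsetSum]
      rw [eval_mul, eval_X, eval_finsetSum] at h1
      simp only [eval_mul, eval_C] at h1
      have h3 : (fun k => (curve e t k - incidence t b *
          (X * C ((∑ j, e j) k) + C (w k))).eval s) =
          ∑ i, (nodalExcept t i).eval s • (e i - (b i * t i) • ∑ j, e j - b i • w) := by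
        ext k
        simp only [smul_sub, Finset.sum_sub_distrib, smul_smul, ← Finset.sum_smul, Pi.sub_apply,
          Pi.smul_apply, smul_eq_mul, eval_sub, eval_mul, eval_add, eval_X, eval_C, curve,
          eval_finsetSum]
        have h4 : ∑ i, eval s (nodalExcept t i) * (b i * t i) = s * eval s (incidence t b) := by
          rw [h1]; exact Finset.sum_congr rfl fun i _ => mul_comm _ _
        have h5 : ∑ i, eval s (nodalExcept t i) * b i = eval s (incidence t b) := by
          rw [h2]; exact Finset.sum_congr rfl fun i _ => mul_comm _ _
        rw [h4, h5, Finset.sum_apply (a := k) (g := fun i => eval s (nodalExcept t i) • e i)]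
        simp only [Pi.smul_apply, smul_eq_mul, mul_comm (eval s (nodalExcept t _))]
        ring
      rw [h3]
      exact Submodule.sum_mem _ fun i _ => Submodule.smul_mem _ _ (hΛ i)
    · rw [sub_sub_cancel]
      exact dvd_mul_right _ _
  rw [mul_pow]
  refine IsCoprime.mul_dvd (IsCoprime.pow (IsCoprime.prod_left fun i _ => ?_)) ?_ hinc
  · refine (irreducible_X_sub_C (t i)).isCoprime_or_dvd _ |>.resolve_right fun h => ?_
    rw [dvd_iff_isRoot, IsRoot.def, incidence, eval_sum_nodalExcept] at h
    exact mul_ne_zero (hb0 i) (eval_nodalExcept_self t ht) h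
  · rw [← Finset.prod_pow]
    refine Finset.prod_dvd_of_coprime (fun i _ j _ hij => ?_) fun i _ => hpt i
    exact (isCoprime_X_sub_C_of_isUnit_sub (sub_ne_zero.2 (ht.ne hij)).isUnit).pow

/-- Quartics singular at the points `e i` and along a suitable codimension two space cannot have
arbitrary first order behaviour at `∑ i, e i`. -/
lemma exists_quartic_sub_notMem (hn : 0 < n) (ht : Function.Injective t) (hb0 : ∀ i, b i ≠ 0)
    (hb : ∑ i, b i = 0) (hbt : ∑ i, b i * t i = 1)
    {Λ : Submodule ℂ (Fin (n + 1) → ℂ)} {w : Fin (n + 1) → ℂ}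
    (hΛ : ∀ i, e i - (b i * t i) • ∑ j, e j - b i • w ∈ Λ) :
    ∃ F₀ ∈ MvPolynomial.homogeneousSubmodule (Fin (n + 1)) ℂ 4,
      ∀ F ∈ MvPolynomial.homogeneousSubmodule (Fin (n + 1)) ℂ 4,
        (∀ i, F ∈ linearIdeal (ℂ ∙ e i) ^ 2) → F ∈ linearIdeal Λ ^ 2 →
          F - F₀ ∉ linearIdeal (ℂ ∙ ∑ i, e i) ^ 2 := by
  have h01 : (0 : Fin (n + 1)) ≠ Fin.last n := by
    simpa [Fin.ext_iff] using hn.ne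
  -- All coordinates of `∑ e i` are 1, so this quartic vanishes there; along the curve the zero is
  -- simple because `t 0 ≠ t n`.
  refine ⟨linForm n (e.coord 0) ^ 3 * (linForm n (e.coord 0) - linForm n (e.coord (Fin.last n))),
    ?_, fun F hF hFe hFΛ hF₀ => ?_⟩
  · exact ((isHomogeneous_linForm _).pow 3).mul
      ((isHomogeneous_linForm _).sub (isHomogeneous_linForm _))
  obtain ⟨hdeg, hrefl⟩ := natDegree_aeval_le_and_reflect_aeval (natDegree_curve_le e t)
    (reflect_curve e t) hF
  have hsq : X ^ 2 ∣ MvPolynomial.aeval (revCurve e t) (F - linForm n (e.coord 0) ^ 3 *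
      (linForm n (e.coord 0) - linForm n (e.coord (Fin.last n)))) := by
    refine sq_dvd_aeval (ρ := fun k => C ((∑ i, e i) k)) (fun s => ?_) (fun k => ?_) hF₀
    · simp only [eval_C]
      exact Submodule.mem_span_singleton_self _
    · rw [X_dvd_iff, coeff_zero_eq_eval_zero, revCurve]
      simp [eval_finsetSum, eval_zero_revNodalExcept]
  obtain ⟨r, hr⟩ := hsq
  obtain ⟨q, hq, hsub⟩ := revNodalExcept_sub t h01
  have hcoord : ∀ j, MvPolynomial.aeval (revCurve e t) (linForm n (e.coord j)) =
      revNodalExcept t j := aeval_linForm_coord e _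
  rw [map_sub, map_mul, map_pow, map_sub, hcoord, hcoord, hsub, sub_eq_iff_eq_add] at hr
  have hfac : MvPolynomial.aeval (revCurve e t) F =
      X * (X * r + revNodalExcept t 0 ^ 3 * (C (t 0 - t (Fin.last n)) * q)) := by
    rw [hr]; ring
  -- The bracket in `hfac` is `t 0 - t n ≠ 0` at 0, so the pullback of `F` also has exactly a simple
  -- zero at infinity.
  have hne : MvPolynomial.aeval (curve e t) F ≠ 0 := by
    intro h0
    rw [h0, reflect_zero] at hrefl
    rw [hfac, eq_comm, mul_eq_zero, or_iff_right X_ne_zero] at hrefl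
    have := congrArg (eval 0) hrefl
    simp only [eval_add, eval_mul, eval_X, zero_mul, zero_add, eval_pow, eval_C, hq,
      eval_zero_revNodalExcept, one_pow, one_mul, mul_one, eval_zero] at this
    exact h01 (ht (sub_eq_zero.1 this))
  -- The coefficient of degree `4n` is the value at infinity, which is zero: the degree drops below
  -- `4n`.
  have htop : (MvPolynomial.aeval (curve e t) F).coeff (4 * n) = 0 := by
    have h := congrArg (fun p => coeff p 0) hrefl
    simp only [coeff_reflect, revAt_zero] at h
    rw [h, hfac]
    simp
  have hlt : (MvPolynomial.aeval (curve e t) F).natDegree < 4 * n := by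
    refine lt_of_le_of_ne hdeg fun h => hne ?_
    rw [← h] at htop
    exact leadingCoeff_eq_zero.1 htop
  -- The divisor has degree `2((n + 1) + (n - 1)) = 4n`, too large for a nonzero multiple of smaller
  -- degree.
  have hdvd := natDegree_le_of_dvd (sq_dvd_aeval_curve e ht hb0 hb hΛ hFe hFΛ) hne
  obtain ⟨hmon, hnat⟩ := X_mul_incidence_monic hb hbt
  have hmon' : (incidence t b).Monic := monic_X.of_mul_monic_left hmon
  rw [monic_X.natDegree_mul hmon', natDegree_X] at hnat
  rw [((monic_prod_X_sub_C t Finset.univ).mul hmon').natDegree_pow,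
    (monic_prod_X_sub_C t Finset.univ).natDegree_mul hmon',
    natDegree_finsetProd_X_sub_C_eq_card] at hdvd
  simp only [Finset.card_univ, Fintype.card_fin] at hdvd
  omega

end

end DoubleSchemes

/-! ### General position as a nonempty open condition. -/

namespace DoubleSchemes

open Module

/-- Any `n + 1` of the points span `ℙⁿ`, and projecting from the linear space maps the points to
distinct points of a line. -/
structure Configuration.IsGeneral {n : ℕ} (c : Configuration n) : Prop where
  linearIndependent (k : Fin (n + 2)) :
    LinearIndependent ℂ fun i => (c.point (k.succAbove i)).rep
  eq_zero_of_mem {i j : Fin (n + 2)} (hij : i ≠ j) (s r : ℂ) :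
    s • (c.point i).rep + r • (c.point j).rep ∈ c.space → s = 0 ∧ r = 0

/-- The condition expressing general position in terms of coordinates. -/
noncomputable def generalPolynomial (n : ℕ) : MvPolynomial (CoordIndex n) ℂ :=
  (∏ k : Fin (n + 2),
      (Matrix.of fun i j => MvPolynomial.X (Sum.inl (k.succAbove i), j) :
        Matrix (Fin (n + 1)) (Fin (n + 1)) (MvPolynomial (CoordIndex n) ℂ)).det) *
    ∏ p ∈ (Finset.univ : Finset (Fin (n + 2))).offDiag,
      ((∑ j, MvPolynomial.X (Sum.inr 0, j) * MvPolynomial.X (Sum.inl p.1, j)) *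
          (∑ j, MvPolynomial.X (Sum.inr 1, j) * MvPolynomial.X (Sum.inl p.2, j)) -
        (∑ j, MvPolynomial.X (Sum.inr 0, j) * MvPolynomial.X (Sum.inl p.2, j)) *
          (∑ j, MvPolynomial.X (Sum.inr 1, j) * MvPolynomial.X (Sum.inl p.1, j)))

lemma eval_generalPolynomial_ne_zero {n : ℕ} (a : CoordIndex n → ℂ) :
    MvPolynomial.eval a (generalPolynomial n) ≠ 0 ↔
      (∀ k : Fin (n + 2), (Matrix.of fun i j => a (Sum.inl (k.succAbove i), j) :
        Matrix (Fin (n + 1)) (Fin (n + 1)) ℂ).det ≠ 0) ∧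
      ∀ p q : Fin (n + 2), p ≠ q →
        (∑ j, a (Sum.inr 0, j) * a (Sum.inl p, j)) * (∑ j, a (Sum.inr 1, j) * a (Sum.inl q, j)) -
          (∑ j, a (Sum.inr 0, j) * a (Sum.inl q, j)) *
            (∑ j, a (Sum.inr 1, j) * a (Sum.inl p, j)) ≠ 0 := by
  rw [generalPolynomial, map_mul, map_prod, map_prod, mul_ne_zero_iff, Finset.prod_ne_zero_iff,
    Finset.prod_ne_zero_iff]
  refine and_congr (by
    simp only [RingHom.map_det, Finset.mem_univ, true_imp_iff]
    refine forall_congr' fun k => ?_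
    rw [show (MvPolynomial.eval a).mapMatrix (Matrix.of fun i j =>
        MvPolynomial.X (Sum.inl (k.succAbove i), j)) =
      (Matrix.of fun i j => a (Sum.inl (k.succAbove i), j) :
        Matrix (Fin (n + 1)) (Fin (n + 1)) ℂ) by ext; simp]) ?_
  simp [Prod.forall]

lemma pair_eq_zero_iff (a b c d : ℂ) :
    (∀ s r : ℂ, s * a + r * b = 0 → s * c + r * d = 0 → s = 0 ∧ r = 0) ↔ a * d - b * c ≠ 0 := by
  constructor
  · intro h h0
    -- If the determinant is zero, its cofactors solve the system, so all entries vanish and `(1,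
    -- 1)` is a nonzero solution.
    obtain ⟨hd, hc⟩ := h d (-c) (by linear_combination h0) (by ring)
    obtain ⟨hb, ha⟩ := h b (-a) (by ring) (by linear_combination -h0)
    rw [neg_eq_zero] at hc ha
    exact one_ne_zero (h 1 1 (by simp [ha, hb]) (by simp [hc, hd])).1
  · intro h s r h1 h2
    refine ⟨?_, ?_⟩ <;> refine (mul_eq_zero.1 ?_).resolve_right h
    · linear_combination d * h1 - b * h2
    · linear_combination a * h2 - c * h1

/-- Both conditions are unchanged by rescaling the points, so `rep` may be traded for any
homogeneous coordinates. -/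
lemma Configuration.isGeneral_iff_eval_ne_zero {n : ℕ} {c : Configuration n}
    {a : CoordIndex n → ℂ} (ha : c.IsCoordinates a) :
    c.IsGeneral ↔ MvPolynomial.eval a (generalPolynomial n) ≠ 0 := by
  rw [eval_generalPolynomial_ne_zero]
  have hu : ∀ i, ∃ u : ℂˣ, u • (fun j => a (Sum.inl i, j)) = (c.point i).rep := by
    intro i
    obtain ⟨h, hi⟩ := ha.1 i
    rw [← hi]
    exact Projectivization.exists_smul_eq_mk_rep ℂ _ h
  choose u hu using hu
  have h1 : ∀ k : Fin (n + 2), (LinearIndependent ℂ fun i => (c.point (k.succAbove i)).rep) ↔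
      (Matrix.of fun i j => a (Sum.inl (k.succAbove i), j) :
        Matrix (Fin (n + 1)) (Fin (n + 1)) ℂ).det ≠ 0 := by
    intro k
    rw [← isUnit_iff_ne_zero, ← Matrix.isUnit_iff_isUnit_det,
      ← Matrix.linearIndependent_rows_iff_isUnit,
      ← LinearIndependent.units_smul_iff (Matrix.row _) fun i => u (k.succAbove i)]
    simp_rw [← hu]
    rfl
  have h2 : ∀ p q : Fin (n + 2),
      (∀ s r : ℂ, s • (c.point p).rep + r • (c.point q).rep ∈ c.space → s = 0 ∧ r = 0) ↔
      (∑ j, a (Sum.inr 0, j) * a (Sum.inl p, j)) * (∑ j, a (Sum.inr 1, j) * a (Sum.inl q, j)) -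
          (∑ j, a (Sum.inr 0, j) * a (Sum.inl q, j)) *
            (∑ j, a (Sum.inr 1, j) * a (Sum.inl p, j)) ≠ 0 := by
    intro p q
    rw [← pair_eq_zero_iff]
    have hmem : ∀ s r : ℂ, s • (fun j => a (Sum.inl p, j)) + r • (fun j => a (Sum.inl q, j)) ∈
        c.space ↔ s * (∑ j, a (Sum.inr 0, j) * a (Sum.inl p, j)) +
            r * (∑ j, a (Sum.inr 0, j) * a (Sum.inl q, j)) = 0 ∧
          s * (∑ j, a (Sum.inr 1, j) * a (Sum.inl p, j)) +
            r * (∑ j, a (Sum.inr 1, j) * a (Sum.inl q, j)) = 0 := by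
      intro s r
      rw [ha.2, Fin.forall_fin_two]
      simp only [Pi.add_apply, Pi.smul_apply, smul_eq_mul, mul_add, Finset.sum_add_distrib,
        mul_left_comm _ s, mul_left_comm _ r, ← Finset.mul_sum]
    simp_rw [← hu, Units.smul_def, smul_smul, hmem]
    constructor
    · intro h s r hs hr
      have := h (s * (u p)⁻¹.1) (r * (u q)⁻¹.1) (by simpa using ⟨hs, hr⟩)
      simpa using this
    · rintro h s r ⟨hs, hr⟩
      simpa using h _ _ hs hr
  constructor
  · exact fun h => ⟨fun k => (h1 k).1 (h.linearIndependent k),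
      fun p q hpq => (h2 p q).1 (h.eq_zero_of_mem hpq)⟩
  · exact fun h => ⟨fun k => (h1 k).2 (h.1 k), fun hpq => (h2 _ _).2 (h.2 _ _ hpq)⟩

lemma isZariskiOpen_isGeneral (n : ℕ) : IsZariskiOpen {c : Configuration n | c.IsGeneral} :=
  ⟨{generalPolynomial n}, fun c a ha => by
    simpa using Configuration.isGeneral_iff_eval_ne_zero ha⟩

/-- Points on the moment curve, together with a coordinate subspace, are in general position. -/
lemma exists_isGeneral {n : ℕ} (hn : 0 < n) : ∃ c : Configuration n, c.IsGeneral := by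
  let f : Fin 2 → Fin (n + 1) := Fin.castLE (by omega)
  have hf : Function.Injective f := Fin.castLE_injective _
  let v : Fin (n + 2) → Fin (n + 1) → ℂ := fun i j => (i.val : ℂ) ^ (j : ℕ)
  have hv : ∀ i, v i ≠ 0 := fun i h => by simpa [v] using congrFun h 0
  let c : Configuration n :=
    { point := fun i => Projectivization.mk ℂ (v i) (hv i)
      space := LinearMap.ker (LinearMap.funLeft ℂ ℂ f)
      codim_space := by
        rw [((LinearMap.funLeft ℂ ℂ f).quotKerEquivOfSurjective
          (LinearMap.funLeft_surjective_of_injective ℂ ℂ f hf)).finrank_eq]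
        simp }
  let a : CoordIndex n → ℂ := fun p => Sum.elim (fun i => v i p.2)
    (fun k => if p.2 = f k then 1 else 0) p.1
  have ha : c.IsCoordinates a := by
    refine ⟨fun i => ⟨hv i, rfl⟩, fun x => ?_⟩
    simp [c, a, LinearMap.mem_ker, funext_iff, LinearMap.funLeft_apply]
  refine ⟨c, (Configuration.isGeneral_iff_eval_ne_zero ha).2
    ((eval_generalPolynomial_ne_zero a).2 ⟨fun k => ?_, fun p q hpq => ?_⟩)⟩
  · refine (Matrix.det_vandermonde_ne_zero_iff
      (v := fun i => ((k.succAbove i).val : ℂ))).2 fun i j h => ?_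
    exact Fin.succAbove_right_injective (Fin.ext (Nat.cast_injective h))
  -- Projection from the coordinate subspace sends point `i` to `(1, i)`, so the determinant is a
  -- difference of parameters.
  · have h0 : (f 0 : ℕ) = 0 := rfl
    have h1 : (f 1 : ℕ) = 1 := rfl
    simp only [a, Sum.elim_inl, Sum.elim_inr, ite_mul, one_mul, zero_mul, Finset.sum_ite_eq',
      Finset.mem_univ, if_true, v, h0, h1, pow_zero, pow_one]
    rw [sub_ne_zero]
    exact fun h => hpq (Fin.ext (Nat.cast_injective h)).symm

/-! ### Dependent conditions and the dimension count. -/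

lemma mem_degreePart {n d : ℕ} {I : Ideal (CoordRing n)}
    {F : MvPolynomial.homogeneousSubmodule (Fin (n + 1)) ℂ d} :
    F ∈ degreePart I d ↔ (F : CoordRing n) ∈ I := Iff.rfl

/-- If the conditions `x ∈ p i` and `x ∈ q` on vectors `x` are dependent, then they cut out a
subspace of codimension less than the sum of the codimensions. -/
lemma finrank_quotient_iInf_inf_lt {V ι : Type*} [AddCommGroup V] [Module ℂ V]
    [FiniteDimensional ℂ V] [Fintype ι] (p : ι → Submodule ℂ V) (q : Submodule ℂ V)
    (i₀ : ι) (v : V) (hv : ∀ x, (∀ i, i ≠ i₀ → x ∈ p i) → x ∈ q → x - v ∉ p i₀) :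
    finrank ℂ (V ⧸ ((⨅ i, p i) ⊓ q)) < ∑ i, finrank ℂ (V ⧸ p i) + finrank ℂ (V ⧸ q) := by
  classical
  let Φ := (LinearMap.pi fun i => (p i).mkQ).prod q.mkQ
  have hker : LinearMap.ker Φ = (⨅ i, p i) ⊓ q := by
    simp [Φ, LinearMap.ker_prod, LinearMap.ker_pi]
  have hrange : LinearMap.range Φ ≠ ⊤ := by
    intro htop
    -- A preimage of the class of `v` in slot `i₀`, zero elsewhere, is what `hv` excludes.
    obtain ⟨x, hx⟩ := LinearMap.range_eq_top.1 htop (Pi.single i₀ ((p i₀).mkQ v), 0)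
    obtain ⟨h1, h2⟩ := Prod.ext_iff.1 hx
    refine hv x (fun i hi => ?_) ((Submodule.Quotient.mk_eq_zero _).1 h2) ?_
    · exact (Submodule.Quotient.mk_eq_zero _).1
        ((congrFun h1 i).trans (Pi.single_eq_of_ne hi _))
    · exact (Submodule.Quotient.eq _).1
        ((congrFun h1 i₀).trans (Pi.single_eq_same i₀ _))
  have hlt := Submodule.finrank_lt hrange
  rwa [← Φ.quotKerEquivRange.finrank_eq, hker, finrank_prod, finrank_pi_fintype] at hlt

namespace Configuration

variable {n : ℕ} {c : Configuration n}

/-- Configurations in general position admit a basis of vectors representing all points but the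
last, whose sum represents the last. -/
lemma IsGeneral.exists_basis (h : c.IsGeneral) :
    ∃ (e : Basis (Fin (n + 1)) ℂ (Fin (n + 1) → ℂ)) (u : Fin (n + 1) → ℂ),
      (∀ i, u i ≠ 0) ∧ (∀ i, e i = u i • (c.point i.castSucc).rep) ∧
        ∑ i, e i = (c.point (Fin.last (n + 1))).rep := by
  have hli := h.linearIndependent (Fin.last (n + 1))
  simp only [Fin.succAbove_last] at hli
  let v := basisOfLinearIndependentOfCardEqFinrank hli (by simp)
  have hv : ∀ i, v i = (c.point i.castSucc).rep := fun i => by simp [v]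
  set x := (c.point (Fin.last (n + 1))).rep with hx
  have hu : ∀ i, v.repr x i ≠ 0 := by
    intro i hi
    -- If coordinate `i` of the last point were zero, the `n + 1` points other than `i` would
    -- satisfy a relation with coefficient `-1` at the last one.
    let g : Fin (n + 2) → ℂ := Fin.snoc (v.repr x) (-1)
    have hsum : ∑ m, g m • (c.point m).rep = 0 := by
      rw [Fin.sum_univ_castSucc]
      simp only [g, Fin.snoc_castSucc, Fin.snoc_last, ← hv, v.sum_repr, ← hx]
      simp
    rw [Fin.sum_univ_succAbove _ i.castSucc] at hsum
    have hg : g i.castSucc = 0 := by simp [g, hi]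
    rw [hg, zero_smul, zero_add] at hsum
    obtain ⟨j, hj⟩ := Fin.exists_succAbove_eq (Fin.castSucc_lt_last i).ne'
    have := Fintype.linearIndependent_iff.1 (h.linearIndependent i.castSucc)
      (fun j => g (i.castSucc.succAbove j)) hsum j
    simp [hj, g] at this
  refine ⟨v.isUnitSMul fun i => (hu i).isUnit, v.repr x, hu, fun i => ?_, ?_⟩
  · rw [Basis.isUnitSMul_apply, hv]
  · simp only [Basis.isUnitSMul_apply, v.sum_repr]

/-- General position yields forms of degree four showing that the conditions imposed by the double
points and the double linear space are dependent. -/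
lemma IsGeneral.exists_quartic_sub_notMem (hn : 0 < n) (h : c.IsGeneral) :
    ∃ F₀ ∈ MvPolynomial.homogeneousSubmodule (Fin (n + 1)) ℂ 4,
      ∀ F ∈ MvPolynomial.homogeneousSubmodule (Fin (n + 1)) ℂ 4,
        (∀ i : Fin (n + 1), F ∈ linearIdeal (c.point i.castSucc).submodule ^ 2) →
          F ∈ linearIdeal c.space ^ 2 →
            F - F₀ ∉ linearIdeal (c.point (Fin.last (n + 1))).submodule ^ 2 := by
  obtain ⟨e, u, hu, he, hsum⟩ := h.exists_basis
  have hinf : ∀ i, ∀ s r : ℂ, s • e i + r • ∑ j, e j ∈ c.space → s = 0 ∧ r = 0 := by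
    intro i s r hm
    rw [hsum, he, smul_smul] at hm
    obtain ⟨h1, h2⟩ := h.eq_zero_of_mem (Fin.castSucc_lt_last i).ne _ _ hm
    exact ⟨(mul_eq_zero.1 h1).resolve_right (hu i), h2⟩
  have hfin : ∀ i j, i ≠ j → ∀ s r : ℂ, s • e i + r • e j ∈ c.space → s = 0 ∧ r = 0 := by
    intro i j hij s r hm
    rw [he, he, smul_smul, smul_smul] at hm
    obtain ⟨h1, h2⟩ := h.eq_zero_of_mem ((Fin.castSucc_injective _).ne hij) _ _ hm
    exact ⟨(mul_eq_zero.1 h1).resolve_right (hu i), (mul_eq_zero.1 h2).resolve_right (hu j)⟩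
  -- The images of `w = e 0` and `p = ∑ e j` form a basis of the plane `ℂⁿ⁺¹ / Λ`; expanding each `e
  -- i` in it gives `a i` and `b i`.
  have hli : LinearIndependent ℂ ![c.space.mkQ (e 0), c.space.mkQ (∑ j, e j)] := by
    rw [LinearIndependent.pair_iff]
    intro s r hsr
    rw [← map_smul c.space.mkQ, ← map_smul c.space.mkQ, ← map_add, Submodule.mkQ_apply,
      Submodule.Quotient.mk_eq_zero] at hsr
    exact hinf 0 s r hsr
  let B := basisOfLinearIndependentOfCardEqFinrank hli (by simp [c.codim_space])
  have hab : ∀ i, ∃ a b : ℂ, e i - a • ∑ j, e j - b • e 0 ∈ c.space := by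
    intro i
    refine ⟨B.repr (c.space.mkQ (e i)) 1, B.repr (c.space.mkQ (e i)) 0, ?_⟩
    have := B.sum_repr (c.space.mkQ (e i))
    rw [Fin.sum_univ_two] at this
    simp only [B, coe_basisOfLinearIndependentOfCardEqFinrank, Matrix.cons_val_zero,
      Matrix.cons_val_one] at this
    rw [← Submodule.Quotient.mk_eq_zero, ← Submodule.mkQ_apply, map_sub, map_sub, map_smul,
      map_smul, sub_sub, sub_eq_zero]
    exact this.symm.trans (add_comm _ _)
  choose a b hab using hab
  have hb : ∀ i, b i ≠ 0 := by
    intro i hi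
    have := hab i
    rw [hi, zero_smul, sub_zero, sub_eq_add_neg, ← neg_smul, ← one_smul ℂ (e i)] at this
    exact one_ne_zero (hinf i _ _ this).1
  -- The parameter `a i / b i` is the affine coordinate of the projection of `e i` from `Λ`; equal
  -- values would put `b j • e i - b i • e j` in the space.
  have ht : Function.Injective fun i => a i / b i := by
    intro i j hij
    by_contra hne
    rw [div_eq_div_iff (hb i) (hb j)] at hij
    have hm := c.space.sub_mem (c.space.smul_mem (b j) (hab i)) (c.space.smul_mem (b i) (hab j))
    have heq : b j • (e i - a i • ∑ j, e j - b i • e 0) -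
        b i • (e j - a j • ∑ j, e j - b j • e 0) = b j • e i + (-b i) • e j := by
      have : (b j * a i) • ∑ j, e j = (b i * a j) • ∑ j, e j := by
        rw [mul_comm (b j), hij, mul_comm]
      simp only [smul_sub, smul_smul, this, mul_comm (b j) (b i), neg_smul]
      abel
    rw [heq] at hm
    exact hb j (hfin i j hne _ _ hm).1
  -- Summing the congruences expresses `p` through `p` and `w`; comparing coefficients yields `∑ b i
  -- = 0` and `∑ a i = 1`.
  have htot : (-∑ i, b i) • e 0 + (1 - ∑ i, a i) • ∑ j, e j ∈ c.space := by
    have := c.space.sum_mem fun i (_ : i ∈ Finset.univ) => hab i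
    rw [Finset.sum_sub_distrib, Finset.sum_sub_distrib, ← Finset.sum_smul, ← Finset.sum_smul] at this
    convert this using 1
    rw [sub_smul, one_smul, neg_smul]
    abel
  obtain ⟨hb0, ha1⟩ := hinf 0 _ _ htot
  have hba : ∀ i, b i * (a i / b i) = a i := fun i => mul_div_cancel₀ _ (hb i)
  obtain ⟨F₀, hF₀, hF⟩ := DoubleSchemes.exists_quartic_sub_notMem e hn ht hb (neg_eq_zero.1 hb0)
    (by simp only [hba]; exact (sub_eq_zero.1 ha1).symm) (Λ := c.space) (w := e 0)
    (by simpa only [hba] using hab)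
  refine ⟨F₀, hF₀, fun F hFh hFe hFΛ => ?_⟩
  rw [Projectivization.submodule_eq, ← hsum]
  refine hF F hFh (fun i => ?_) hFΛ
  have := hFe i
  rwa [Projectivization.submodule_eq, ← Submodule.span_singleton_smul_eq (hu i).isUnit,
    ← he] at this

lemma finrank_quotient_point_le (i : Fin (n + 2)) :
    finrank ℂ (MvPolynomial.homogeneousSubmodule (Fin (n + 1)) ℂ 4 ⧸
      degreePart (linearIdeal (c.point i).submodule ^ 2) 4) ≤ n + 1 := by
  have h := finrank_quotient_linearIdeal_sq_le (c.point i).submodule 3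
  have hq := (c.point i).submodule.finrank_quotient_add_finrank
  rw [Projectivization.finrank_submodule, finrank_fin_fun] at hq
  rw [Projectivization.finrank_submodule, Nat.add_right_cancel hq, Nat.multichoose_one,
    Nat.multichoose_one] at h
  exact h.trans (by omega)

lemma finrank_quotient_space_le (hn : 0 < n) :
    finrank ℂ (MvPolynomial.homogeneousSubmodule (Fin (n + 1)) ℂ 4 ⧸
      degreePart (linearIdeal c.space ^ 2) 4) ≤ (n + 2).choose 4 + 2 * (n + 1).choose 3 := by
  have h := finrank_quotient_linearIdeal_sq_le c.space 3
  have hq := c.space.finrank_quotient_add_finrank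
  rw [c.codim_space, finrank_fin_fun] at hq
  rw [c.codim_space, Nat.multichoose_eq, Nat.multichoose_eq,
    show finrank ℂ c.space + (3 + 1) - 1 = n + 2 by omega,
    show finrank ℂ c.space + 3 - 1 = n + 1 by omega] at h
  exact h

lemma IsGeneral.hilbertFunction_le (hn : 0 < n) (h : c.IsGeneral) :
    hilbertFunction c.doubleIdeal 4 ≤ expectedHilbert n - 1 := by
  have : FiniteDimensional ℂ (MvPolynomial.homogeneousSubmodule (Fin (n + 1)) ℂ 4) :=
    Module.Finite.iff_fg.2 (MvPolynomial.homogeneousSubmodule_fg _ _ 4)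
  obtain ⟨F₀, hF₀, hF⟩ := h.exists_quartic_sub_notMem hn
  have hlt := finrank_quotient_iInf_inf_lt
    (fun i => degreePart (linearIdeal (c.point i).submodule ^ 2) 4)
    (degreePart (linearIdeal c.space ^ 2) 4) (Fin.last (n + 1)) ⟨F₀, hF₀⟩
    fun F hFe hFΛ => hF F F.2 (fun i => mem_degreePart.1 (hFe i.castSucc (Fin.castSucc_lt_last i).ne))
      (mem_degreePart.1 hFΛ)
  have hker : degreePart c.doubleIdeal 4 =
      (⨅ i, degreePart (linearIdeal (c.point i).submodule ^ 2) 4) ⊓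
        degreePart (linearIdeal c.space ^ 2) 4 := by
    ext F
    simp [degreePart, doubleIdeal]
  rw [← hker] at hlt
  have hpts := Finset.sum_le_card_nsmul Finset.univ _ (n + 1)
    fun i _ => finrank_quotient_point_le (c := c) i
  rw [Finset.card_univ, Fintype.card_fin, smul_eq_mul] at hpts
  have hsp := finrank_quotient_space_le (c := c) hn
  rw [hilbertFunction, expectedHilbert]
  omega

end Configuration

end DoubleSchemes

theorem lemma5p1 (n : ℕ) (hn : 2 < n) :
    DoubleSchemes.HoldsGenerically (fun c : DoubleSchemes.Configuration n =>
      DoubleSchemes.hilbertFunction c.doubleIdeal 4 ≤ DoubleSchemes.expectedHilbert n - 1) := by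
  have hn' : 0 < n := by omega
  exact ⟨{c | c.IsGeneral}, DoubleSchemes.isZariskiOpen_isGeneral n,
    DoubleSchemes.exists_isGeneral hn', fun _ hc => hc.hilbertFunction_le hn'⟩
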